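/- All graphs are finite and simple. For a graph $H$, let $\alpha(H)$ be its independence number, let $\mathrm{Supp}(H)$ be the set of vertices $w$ of $H$ such that $x_w\neq 0$ for some real vector $x$ in the null space of the adjacency matrix of $H$, and let $N[\mathrm{Supp}(H)]$ be the set $\mathrm{Supp}(H)$ together with all neighbours of its vertices. For a tree $T$, the $S$-forest $\mathcal{F}_S(T)$ is the subgraph of $T$ induced by $N[\mathrm{Supp}(T)]$, and the $N$-forest $\mathcal{F}_N(T)$ is the graph obtained from $T$ by deleting the vertices of $\mathcal{F}_S(T)$. Let $G$ be a unicyclic graph, that is, a connected graph with exactly one cycle $C$. For a vertex $v$ of $C$, the pendant tree $G\{v\}$ is the largest connected induced subgraph of $G$ that contains $v$ and no other vertex of $C$, and $G-G\{v\}$ is the graph (again a tree) obtained from $G$ by deleting the vertices of $G\{v\}$. The graph $G$ is of Type I if there is a vertex $u$ of $C$ that is saturated by every maximum matching of $G\{u\}$. Theorem. Let $G$ be a unicyclic graph of Type I with cycle $C$, and let $v$ be a vertex of $C$ such that $v\notin \mathrm{Supp}(G\{v\})$. Then $$\alpha(G)=|\mathrm{Supp}(G\{v\})|+|\mathrm{Supp}(G-G\{v\})|+\frac{|V(\mathcal{F}_N(G\{v\}))|+|V(\mathcal{F}_N(G-G\{v\}))|}{2}.$$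 -/

import Mathlib

namespace NullDecomp

/-- The subgraph `C` of `G` is a cycle of `G`. -/
def IsCycleSubgraph {V : Type*} {G : SimpleGraph V} (C : G.Subgraph) : Prop :=
  ∃ (u : V) (p : G.Walk u u), p.IsCycle ∧ p.toSubgraph = C

/-- A unicyclic graph: connected, with exactly one cycle. -/
def IsUnicyclic {V : Type*} (G : SimpleGraph V) : Prop :=
  G.Connected ∧ ∃! C : G.Subgraph, IsCycleSubgraph C

/-- The vertex sets containing `v` and no other vertex of `C` that induce a connected subgraph. -/
def pendantFamily {V : Type*} (G : SimpleGraph V) (C : G.Subgraph) (v : V) : Set (Set V) :=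
  {S | v ∈ S ∧ (∀ w ∈ S, w ∈ C.verts → w = v) ∧ (G.induce S).Connected}

/-- The vertex set of the pendant tree of `G` at `v` (for `v` on the cycle `C`): the largest
vertex set in `pendantFamily G C v`, see `isGreatest_pendantVerts`. -/
def pendantVerts {V : Type*} (G : SimpleGraph V) (C : G.Subgraph) (v : V) : Set V :=
  ⋃₀ pendantFamily G C v

theorem mem_pendantVerts_self {V : Type*} (G : SimpleGraph V) (C : G.Subgraph) (v : V) :
    v ∈ pendantVerts G C v := by
  refine ⟨{v}, ⟨rfl, fun w hw _ => hw, ?_⟩, rfl⟩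
  have : Nonempty ({v} : Set V) := ⟨⟨v, rfl⟩⟩
  refine ⟨fun a b => ?_⟩
  rw [Subsingleton.elim a b]

theorem isGreatest_pendantVerts {V : Type*} (G : SimpleGraph V) (C : G.Subgraph) (v : V) :
    IsGreatest (pendantFamily G C v) (pendantVerts G C v) := by
  refine ⟨⟨mem_pendantVerts_self G C v, ?_, ?_⟩, fun S hS => Set.subset_sUnion_of_mem hS⟩
  · rintro w ⟨S, hS, hw⟩ hwC
    exact hS.2.1 w hw hwC
  · refine SimpleGraph.induce_sUnion_connected_of_pairwise_not_disjoint ?_ ?_ ?_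
    · obtain ⟨S, hS, -⟩ := mem_pendantVerts_self G C v
      exact ⟨S, hS⟩
    · intro S T hS hT
      exact ⟨v, hS.1, hT.1⟩
    · intro S hS
      exact hS.2.2

/-- The pendant tree of `G` at `v`. -/
abbrev pendantTree {V : Type*} (G : SimpleGraph V) (C : G.Subgraph) (v : V) :
    SimpleGraph (pendantVerts G C v) :=
  G.induce (pendantVerts G C v)

/-- The vertex `v`, as a vertex of the pendant tree of `G` at `v`. -/
def pendantRoot {V : Type*} (G : SimpleGraph V) (C : G.Subgraph) (v : V) :
    pendantVerts G C v :=
  ⟨v, mem_pendantVerts_self G C v⟩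

/-- The graph obtained from `G` by deleting the vertices of the pendant tree at `v`. -/
abbrev pendantCompl {V : Type*} (G : SimpleGraph V) (C : G.Subgraph) (v : V) :
    SimpleGraph ((pendantVerts G C v)ᶜ : Set V) :=
  G.induce (pendantVerts G C v)ᶜ

/-- A matching with the largest possible number of edges. -/
def IsMaximumMatching {W : Type*} {T : SimpleGraph W} (M : T.Subgraph) : Prop :=
  M.IsMatching ∧ ∀ M' : T.Subgraph, M'.IsMatching → M'.edgeSet.ncard ≤ M.edgeSet.ncard

/-- `v` is matched in `T`: it is saturated by every maximum matching. (In a one-vertex graph the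
only matching is empty, so that the vertex is mismatched.) -/
def IsMatched {W : Type*} (T : SimpleGraph W) (v : W) : Prop :=
  ∀ M : T.Subgraph, IsMaximumMatching M → v ∈ M.verts

/-- Unicyclic graphs of Type I. -/
def IsTypeI {V : Type*} (G : SimpleGraph V) : Prop :=
  IsUnicyclic G ∧ ∃ C : G.Subgraph, IsCycleSubgraph C ∧
    ∃ v ∈ C.verts, IsMatched (pendantTree G C v) (pendantRoot G C v)

open Classical in
/-- The null space of the real adjacency matrix of `T`. -/
noncomputable def nullSpace {W : Type*} [Finite W] (T : SimpleGraph W) : Submodule ℝ (W → ℝ) :=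
  letI := Fintype.ofFinite W
  LinearMap.ker (T.adjMatrix ℝ).mulVecLin

/-- The support of `T`: vertices at which some vector of the null space is nonzero. -/
def supp {W : Type*} [Finite W] (T : SimpleGraph W) : Set W :=
  {w | ∃ x ∈ nullSpace T, x w ≠ 0}

/-- The S-forest: the subgraph induced by the closed neighbourhood of the support. -/
def sForest {W : Type*} [Finite W] (T : SimpleGraph W) : T.Subgraph :=
  (⊤ : T.Subgraph).induce (supp T ∪ {w | ∃ s ∈ supp T, T.Adj s w})

/-- The N-forest: what remains of `T` after deleting the vertices of the S-forest. -/
def nForest {W : Type*} [Finite W] (T : SimpleGraph W) : T.Subgraph :=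
  (⊤ : T.Subgraph).deleteVerts (sForest T).verts

end NullDecomp

/-!
In a forest, let `l` be a leaf attached at `p`. A null vector vanishes at `p` by the equation at
`l`, so it restricts to a null vector of the forest without `l` and `p`, and conversely the equation
at `p` determines the value at `l`. Hence both the support and the `N`-forest restrict to the
smaller forest, and among `l` and `p` themselves either `l` alone is supported, or both lie in the
`N`-forest: each way `2|supp| + |N|` loses `2`. Since `l` can be put into a maximum independent set,
`α` loses `1`, and `2α = 2|supp| + |N|` for forests. Never choosing `v` as the leaf `l`, the same
reduction produces a maximum independent set that avoids a given vertex `v` outside the support.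

A pendant tree of a unicyclic graph meets the rest of the graph only at its root `v`. If `v` is not
in its support, a maximum independent set avoiding `v` is compatible with every independent set of
the rest, so `α` is the sum of its values on the two forests.
-/

namespace NullDecomp

open SimpleGraph

universe u

section Leaves

variable {W : Type*} {T : SimpleGraph W} {l p w : W}

/-- `l` is a leaf of `T`, attached at `p`. Deleting both ends of such an edge is the reduction step
for forests. -/
def IsLeafAt (T : SimpleGraph W) (l p : W) : Prop :=
  T.neighborSet l = {p}

theorem IsLeafAt.adj_iff (hl : IsLeafAt T l p) : T.Adj l w ↔ w = p := by
  rw [← mem_neighborSet, hl, Set.mem_singleton_iff]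

theorem IsLeafAt.adj (hl : IsLeafAt T l p) : T.Adj l p :=
  hl.adj_iff.2 rfl

theorem IsLeafAt.not_adj_of_mem_compl (hl : IsLeafAt T l p) (hw : w ∈ ({l, p}ᶜ : Set W)) :
    ¬ T.Adj l w :=
  fun h => hw (Or.inr (hl.adj_iff.1 h))

theorem exists_isLeafAt_ne [Finite W] (hT : T.IsAcyclic) (hne : T ≠ ⊥) (v : W) :
    ∃ l p, l ≠ v ∧ IsLeafAt T l p := by
  classical
  have := Fintype.ofFinite W
  obtain ⟨a, b, hab⟩ := ne_bot_iff_exists_adj.1 hne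
  set c := T.connectedComponentMk a
  have hbc : b ∈ c.supp := (c.mem_supp_congr_adj hab).1 rfl
  have : Nontrivial c := ⟨⟨a, rfl⟩, ⟨b, hbc⟩, fun h => hab.ne (congrArg Subtype.val h)⟩
  have isLeafAt_of_degree_eq_one {x : c} (hx : c.toSimpleGraph.degree x = 1) :
      ∃ p, IsLeafAt T x p := by
    obtain ⟨p, hxp, hp⟩ := degree_eq_one_iff_existsUnique_adj.1 hx
    refine ⟨p, Set.eq_singleton_iff_unique_mem.2 ⟨hxp, fun w hxw => ?_⟩⟩
    exact congrArg Subtype.val (hp ⟨w, (c.mem_supp_congr_adj hxw).1 x.2⟩ hxw)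
  obtain ⟨x, y, hxy, hx, hy⟩ := (hT.isTree_connectedComponent c).exists_ne_and_degree_eq_one
  by_cases hxv : (x : W) = v
  · obtain ⟨p, hp⟩ := isLeafAt_of_degree_eq_one hy
    exact ⟨y, p, fun hyv => hxy (Subtype.ext (hxv.trans hyv.symm)), hp⟩
  · obtain ⟨p, hp⟩ := isLeafAt_of_degree_eq_one hx
    exact ⟨x, p, hxv, hp⟩

theorem forest_leaf_induction {P : ∀ {W : Type u} [Finite W], SimpleGraph W → Prop}
    (bot : ∀ {W : Type u} [Finite W], P (⊥ : SimpleGraph W))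
    (step : ∀ {W : Type u} [Finite W] {T : SimpleGraph W}, T.IsAcyclic → T ≠ ⊥ →
      (∀ l p, IsLeafAt T l p → P (T.induce {l, p}ᶜ)) → P T)
    {W : Type u} [Finite W] {T : SimpleGraph W} (hT : T.IsAcyclic) : P T := by
  induction hn : Nat.card W using Nat.strong_induction_on generalizing W with
  | _ n ih =>
  by_cases hbot : T = ⊥
  · exact hbot ▸ bot
  refine step hT hbot fun l p _ => ih _ ?_ (hT.induce _) rfl
  have hl : ({l, p}ᶜ : Set W) ≠ Set.univ := (Set.ne_univ_iff_exists_notMem _).2 ⟨l, by simp⟩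
  exact hn ▸ Set.ncard_lt_card hl

theorem mem_of_mem_support_map_induce {S : Set W} {a b : S} {q : (T.induce S).Walk a b}
    (hw : w ∈ (q.map (Embedding.induce S).toHom).support) : w ∈ S := by
  rw [Walk.support_map, List.mem_map] at hw
  obtain ⟨c, -, rfl⟩ := hw
  exact c.2

theorem not_reachable_induce_of_adj_of_adj (hT : T.IsAcyclic) {S : Set W} (hp : p ∉ S) {a b : S}
    (ha : T.Adj p a) (hb : T.Adj p b) (hab : a ≠ b) : ¬ (T.induce S).Reachable b a := by
  rintro ⟨q⟩
  have hmem := isBridge_iff_forall_walk_mem_edges.1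
    (isAcyclic_iff_forall_adj_isBridge.1 hT ha) (.cons hb (q.map (Embedding.induce S).toHom))
  rcases List.mem_cons.1 hmem with h | h
  · exact hab (Subtype.ext (Sym2.congr_right.1 h))
  · exact hp (mem_of_mem_support_map_induce (Walk.fst_mem_support_of_mem_edges _ h))

end Leaves

section NullSpace

variable {W : Type*} {T : SimpleGraph W} {l p w : W} {x : W → ℝ}

theorem finsum_neighborSet_induce {S : Set W} (u : S) (hx : ∀ w ∉ S, T.Adj u w → x w = 0) :
    ∑ᶠ w ∈ (T.induce S).neighborSet u, x w = ∑ᶠ w ∈ T.neighborSet u, x w := by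
  rw [← finsum_mem_image Subtype.val_injective.injOn]
  refine finsum_mem_inter_support_eq x _ _ (Set.ext fun w => and_congr_left fun hxw => ?_)
  refine ⟨?_, fun huw => ⟨⟨w, ?_⟩, huw, rfl⟩⟩
  · rintro ⟨w, huw, rfl⟩
    exact huw
  · by_contra hw
    exact hxw (hx w hw huw)

variable [Finite W]

theorem mem_nullSpace_iff : x ∈ nullSpace T ↔ ∀ u, ∑ᶠ w ∈ T.neighborSet u, x w = 0 := by
  classical
  let := Fintype.ofFinite W
  simp only [nullSpace, LinearMap.mem_ker, Matrix.mulVecLin_apply, funext_iff, Pi.zero_apply]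
  refine forall_congr' fun u => ?_
  rw [adjMatrix_mulVec_apply, ← finsum_mem_coe_finset, coe_neighborFinset]

theorem supp_bot : supp (⊥ : SimpleGraph W) = Set.univ :=
  Set.eq_univ_of_forall fun _ => ⟨fun _ => 1, by simp [mem_nullSpace_iff], one_ne_zero⟩

theorem indicator_supp_mem_nullSpace (hx : x ∈ nullSpace T) (c : T.ConnectedComponent) :
    c.supp.indicator x ∈ nullSpace T := by
  rw [mem_nullSpace_iff] at hx ⊢
  intro u
  by_cases hu : u ∈ c.supp
  · rw [← hx u]
    exact finsum_mem_congr rfl fun w huw =>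
      Set.indicator_of_mem ((c.mem_supp_congr_adj huw).1 hu) x
  · exact finsum_mem_eq_zero_of_forall_eq_zero fun w huw =>
      Set.indicator_of_notMem (mt (c.mem_supp_congr_adj huw).2 hu) x

theorem IsLeafAt.mem_nullSpace_iff (hl : IsLeafAt T l p) :
    x ∈ nullSpace T ↔ x p = 0 ∧ x l = -∑ᶠ w ∈ T.neighborSet p \ {l}, x w ∧
      x ∘ Subtype.val ∈ nullSpace (T.induce {l, p}ᶜ) := by
  have eq_at_leaf : ∑ᶠ w ∈ T.neighborSet l, x w = x p := by
    rw [hl, finsum_mem_singleton]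
  have eq_at_neighbor : ∑ᶠ w ∈ T.neighborSet p, x w =
      x l + ∑ᶠ w ∈ T.neighborSet p \ {l}, x w := by
    have hlp : l ∈ T.neighborSet p := hl.adj.symm
    rw [← finsum_mem_insert _ (by simp) (Set.toFinite _), Set.insert_sdiff_self_of_mem hlp]
  have eq_elsewhere (hp : x p = 0) (u : ({l, p}ᶜ : Set W)) :
      ∑ᶠ w ∈ (T.induce {l, p}ᶜ).neighborSet u, x w = ∑ᶠ w ∈ T.neighborSet u, x w := by
    refine finsum_neighborSet_induce u fun w hw huw => ?_
    rcases not_not.1 hw with rfl | rfl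
    · exact absurd huw.symm (hl.not_adj_of_mem_compl u.2)
    · exact hp
  simp only [NullDecomp.mem_nullSpace_iff]
  constructor
  · intro hx
    have hp : x p = 0 := eq_at_leaf ▸ hx l
    exact ⟨hp, eq_neg_of_add_eq_zero_left (eq_at_neighbor ▸ hx p),
      fun u => (eq_elsewhere hp u).trans (hx u)⟩
  · rintro ⟨hp, hxl, hx⟩ u
    by_cases hu : u ∈ ({l, p}ᶜ : Set W)
    · exact (eq_elsewhere hp ⟨u, hu⟩).symm.trans (hx ⟨u, hu⟩)
    rcases not_not.1 hu with rfl | rfl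
    · exact eq_at_leaf.trans hp
    · rw [eq_at_neighbor, hxl, neg_add_cancel]

theorem IsLeafAt.exists_mem_nullSpace_comp_val_eq (hl : IsLeafAt T l p)
    {y : ({l, p}ᶜ : Set W) → ℝ} (hy : y ∈ nullSpace (T.induce {l, p}ᶜ)) :
    ∃ x ∈ nullSpace T, x ∘ Subtype.val = y := by
  classical
  let z : W → ℝ := Function.extend Subtype.val y 0
  let x : W → ℝ := Function.update z l (-∑ᶠ w ∈ T.neighborSet p \ {l}, z w)
  have hxz {w : W} (hw : w ≠ l) : x w = z w := Function.update_of_ne hw _ _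
  have hxy : x ∘ Subtype.val = y := by
    funext w
    exact (hxz fun h => w.2 (Or.inl h)).trans (Subtype.val_injective.extend_apply y 0 w)
  refine ⟨x, hl.mem_nullSpace_iff.2 ⟨?_, ?_, hxy ▸ hy⟩, hxy⟩
  · exact (hxz hl.adj.ne').trans (Function.extend_apply' y _ p (by simp))
  · rw [finsum_mem_congr rfl fun w hw => hxz hw.2]
    exact Function.update_self ..

theorem IsLeafAt.notMem_supp (hl : IsLeafAt T l p) : p ∉ supp T := by
  rintro ⟨x, hx, hxp⟩
  exact hxp (hl.mem_nullSpace_iff.1 hx).1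

theorem IsLeafAt.supp_induce_eq (hl : IsLeafAt T l p) :
    supp (T.induce {l, p}ᶜ) = Subtype.val ⁻¹' supp T := by
  ext w
  constructor
  · rintro ⟨y, hy, hyw⟩
    obtain ⟨x, hx, rfl⟩ := hl.exists_mem_nullSpace_comp_val_eq hy
    exact ⟨x, hx, hyw⟩
  · rintro ⟨x, hx, hxw⟩
    exact ⟨_, (hl.mem_nullSpace_iff.1 hx).2.2, hxw⟩

theorem IsLeafAt.mem_supp_of_adj (hT : T.IsAcyclic) (hl : IsLeafAt T l p) (hpw : T.Adj p w)
    (hw : w ∈ supp T) : l ∈ supp T := by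
  by_cases hwl : w = l
  · exact hwl ▸ hw
  have hwm : w ∈ ({l, p}ᶜ : Set W) := by simp [hwl, hpw.ne']
  obtain ⟨y, hy, hyw⟩ : (⟨w, hwm⟩ : ({l, p}ᶜ : Set W)) ∈ supp (T.induce {l, p}ᶜ) :=
    hl.supp_induce_eq ▸ hw
  -- Different neighbours of `p` lie in different components of the rest of the forest, so cutting
  -- `y` off outside the component of `w` leaves only one nonzero term in the equation at `p`.
  obtain ⟨x, hx, hxy⟩ := hl.exists_mem_nullSpace_comp_val_eq <|
    indicator_supp_mem_nullSpace hy ((T.induce {l, p}ᶜ).connectedComponentMk ⟨w, hwm⟩)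
  have hxw : x w = y ⟨w, hwm⟩ :=
    (congrFun hxy ⟨w, hwm⟩).trans (Set.indicator_of_mem (by exact rfl) y)
  have hx0 (u : W) (hpu : T.Adj p u) (hul : u ≠ l) (huw : u ≠ w) : x u = 0 := by
    have hum : u ∈ ({l, p}ᶜ : Set W) := by simp [hul, hpu.ne']
    refine (congrFun hxy ⟨u, hum⟩).trans (Set.indicator_of_notMem (fun h => ?_) y)
    exact not_reachable_induce_of_adj_of_adj hT (by simp) hpw hpu
      (fun h => huw (congrArg Subtype.val h).symm) (ConnectedComponent.exact h)
  refine ⟨x, hx, ?_⟩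
  have hsum : ∑ᶠ u ∈ T.neighborSet p \ {l}, x u = x w := by
    rw [← finsum_mem_singleton (f := x) (a := w)]
    refine finsum_mem_inter_support_eq x _ _ (Set.ext fun u => and_congr_left fun hxu => ?_)
    refine ⟨fun hu => ?_, fun hu => hu ▸ ⟨hpw, hwl⟩⟩
    by_contra huw
    exact hxu (hx0 u hu.1 hu.2 huw)
  rwa [(hl.mem_nullSpace_iff.1 hx).2.1, hsum, hxw, neg_ne_zero]

end NullSpace

section NForest

variable {W : Type*} [Finite W] {T : SimpleGraph W} {l p w : W}

theorem mem_nForest_verts_iff :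
    w ∈ (nForest T).verts ↔ w ∉ supp T ∧ ∀ s ∈ supp T, ¬ T.Adj s w := by
  simp [nForest, sForest]

theorem nForest_bot_verts : (nForest (⊥ : SimpleGraph W)).verts = ∅ :=
  Set.eq_empty_of_forall_notMem fun w hw =>
    (mem_nForest_verts_iff.1 hw).1 (supp_bot (W := W) ▸ Set.mem_univ w)

theorem IsLeafAt.mem_nForest_verts_iff (hl : IsLeafAt T l p) :
    l ∈ (nForest T).verts ↔ l ∉ supp T := by
  refine NullDecomp.mem_nForest_verts_iff.trans (and_iff_left fun s hs hsl => ?_)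
  exact hl.notMem_supp (hl.adj_iff.1 hsl.symm ▸ hs)

theorem IsLeafAt.neighbor_mem_nForest_verts_iff (hT : T.IsAcyclic) (hl : IsLeafAt T l p) :
    p ∈ (nForest T).verts ↔ l ∉ supp T :=
  ⟨fun h hlT => (NullDecomp.mem_nForest_verts_iff.1 h).2 l hlT hl.adj, fun h =>
    NullDecomp.mem_nForest_verts_iff.2 ⟨hl.notMem_supp, fun _ hs hsp =>
      h (hl.mem_supp_of_adj hT hsp.symm hs)⟩⟩

theorem IsLeafAt.nForest_induce_verts_eq (hl : IsLeafAt T l p) :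
    (nForest (T.induce {l, p}ᶜ)).verts = Subtype.val ⁻¹' (nForest T).verts := by
  ext w
  rw [Set.mem_preimage, NullDecomp.mem_nForest_verts_iff, NullDecomp.mem_nForest_verts_iff,
    hl.supp_induce_eq]
  refine and_congr_right fun _ => ⟨fun h s hs hsw => ?_, fun h s => h s⟩
  refine h ⟨s, ?_⟩ hs hsw
  rintro (rfl | rfl)
  · exact hl.not_adj_of_mem_compl w.2 hsw
  · exact hl.notMem_supp hs

theorem ncard_preimage_val_compl_add (A S : Set W) :
    (Subtype.val ⁻¹' A : Set ↥Sᶜ).ncard + (A ∩ S).ncard = A.ncard := by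
  rw [← Set.ncard_inter_add_ncard_sdiff_eq_ncard A S, add_comm]
  exact congrArg _ (Set.ncard_subtype (· ∈ Sᶜ) A)

theorem IsLeafAt.two_mul_ncard_supp_add_ncard_nForest (hT : T.IsAcyclic) (hl : IsLeafAt T l p) :
    2 * (supp T).ncard + (nForest T).verts.ncard =
      2 * (supp (T.induce {l, p}ᶜ)).ncard + (nForest (T.induce {l, p}ᶜ)).verts.ncard + 2 := by
  have pair_contribution :
      2 * (supp T ∩ {l, p}).ncard + ((nForest T).verts ∩ {l, p}).ncard = 2 := by
    have hlN := hl.mem_nForest_verts_iff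
    have hpN := hl.neighbor_mem_nForest_verts_iff hT
    by_cases hlT : l ∈ supp T
    · have hl_notMem : l ∉ (nForest T).verts := hlN.not_left.2 hlT
      have hp_notMem : p ∉ (nForest T).verts := hpN.not_left.2 hlT
      simp [Set.inter_insert_of_mem, Set.inter_insert_of_notMem, hlT, hl.notMem_supp,
        hl_notMem, hp_notMem]
    · have pair_subset : {l, p} ⊆ (nForest T).verts :=
        Set.pair_subset (hlN.2 hlT) (hpN.2 hlT)
      simp [Set.inter_insert_of_notMem, hlT, hl.notMem_supp, Set.inter_eq_right.2 pair_subset,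
        Set.ncard_pair hl.adj.ne]
  rw [hl.supp_induce_eq, hl.nForest_induce_verts_eq,
    ← ncard_preimage_val_compl_add (supp T) {l, p},
    ← ncard_preimage_val_compl_add (nForest T).verts {l, p}]
  lia

end NForest

section IndependentSets

variable {V : Type*} {G : SimpleGraph V} {S : Set V} {I : Finset S} {J : Finset ↥Sᶜ}

theorem isIndepSet_map_val (hI : (G.induce S).IsIndepSet I) :
    G.IsIndepSet (I.map (.subtype (· ∈ S)) : Finset V) := by
  rw [Finset.coe_map]
  exact Subtype.val_injective.injOn.pairwise_image.2 hI

theorem isIndepSet_map_val_union_map_val [DecidableEq V] (hI : (G.induce S).IsIndepSet I)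
    (hJ : (G.induce Sᶜ).IsIndepSet J) (hadj : ∀ a ∈ I, ∀ b ∉ S, ¬ G.Adj a b) :
    G.IsIndepSet (I.map (.subtype (· ∈ S)) ∪ J.map (.subtype (· ∈ Sᶜ)) : Finset V) := by
  have : Std.Symm fun a b => ¬ G.Adj a b := ⟨fun _ _ h hba => h hba.symm⟩
  rw [Finset.coe_union]
  refine Set.pairwise_union_of_symm.2 ⟨isIndepSet_map_val hI, isIndepSet_map_val hJ, ?_⟩
  simp only [Finset.mem_coe, Finset.mem_map]
  rintro _ ⟨a, ha, rfl⟩ _ ⟨b, -, rfl⟩ -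
  exact hadj a ha b b.2

theorem card_map_val_union_map_val [DecidableEq V] (I : Finset S) (J : Finset ↥Sᶜ) :
    (I.map (.subtype (· ∈ S)) ∪ J.map (.subtype (· ∈ Sᶜ))).card = I.card + J.card := by
  rw [Finset.card_union_of_disjoint, Finset.card_map, Finset.card_map]
  simp only [Finset.disjoint_left, Finset.mem_map]
  rintro _ ⟨a, -, rfl⟩ ⟨b, -, hb⟩
  exact b.2 ((show (b : V) = a from hb) ▸ a.2)

variable [Finite V]

theorem card_filter_mem_le_indepNum_induce (S : Set V) [DecidablePred (· ∈ S)] {K : Finset V}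
    (hK : G.IsIndepSet K) : (K.filter (· ∈ S)).card ≤ (G.induce S).indepNum := by
  rw [← Finset.card_subtype]
  refine IsIndepSet.card_le_indepNum fun a ha b hb hab => ?_
  exact hK (Finset.mem_subtype.1 ha) (Finset.mem_subtype.1 hb) (Subtype.coe_ne_coe.2 hab)

theorem indepNum_le_add_indepNum_induce_compl (G : SimpleGraph V) (S : Set V) :
    G.indepNum ≤ (G.induce S).indepNum + (G.induce Sᶜ).indepNum := by
  classical
  obtain ⟨K, hK⟩ := G.exists_isNIndepSet_indepNum
  rw [← hK.card_eq, ← Finset.card_filter_add_card_filter_not (s := K) (· ∈ S)]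
  exact add_le_add (card_filter_mem_le_indepNum_induce S hK.isIndepSet)
    (card_filter_mem_le_indepNum_induce Sᶜ hK.isIndepSet)

theorem isMaximumIndepSet_map_val_union_map_val [DecidableEq V]
    (hI : (G.induce S).IsMaximumIndepSet I) (hJ : (G.induce Sᶜ).IsMaximumIndepSet J)
    (hadj : ∀ a ∈ I, ∀ b ∉ S, ¬ G.Adj a b) :
    G.IsMaximumIndepSet (I.map (.subtype (· ∈ S)) ∪ J.map (.subtype (· ∈ Sᶜ))) where
  isIndepSet := isIndepSet_map_val_union_map_val hI.isIndepSet hJ.isIndepSet hadj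
  maximum t ht := by
    rw [card_map_val_union_map_val, maximumIndepSet_card_eq_indepNum I hI,
      maximumIndepSet_card_eq_indepNum J hJ]
    exact ht.card_le_indepNum.trans (indepNum_le_add_indepNum_induce_compl G S)

theorem indepNum_eq_add_indepNum_induce_compl (hI : (G.induce S).IsMaximumIndepSet I)
    (hadj : ∀ a ∈ I, ∀ b ∉ S, ¬ G.Adj a b) :
    G.indepNum = (G.induce S).indepNum + (G.induce Sᶜ).indepNum := by
  classical
  obtain ⟨J, hJ⟩ := maximumIndepSet_exists (G := G.induce Sᶜ)
  rw [← maximumIndepSet_card_eq_indepNum _ (isMaximumIndepSet_map_val_union_map_val hI hJ hadj),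
    card_map_val_union_map_val, maximumIndepSet_card_eq_indepNum I hI,
    maximumIndepSet_card_eq_indepNum J hJ]

theorem isMaximumIndepSet_singleton_of_isClique (hS : G.IsClique S) (a : S) :
    (G.induce S).IsMaximumIndepSet {a} where
  isIndepSet := by simp
  maximum t ht := by
    rw [Finset.card_singleton, Finset.card_le_one]
    intro b hb c hc
    by_contra hbc
    exact ht hb hc hbc (hS b.2 c.2 (Subtype.coe_ne_coe.2 hbc))

end IndependentSets

section ForestIndependence

variable {W : Type*} [Finite W] {T : SimpleGraph W} {l p : W}

theorem IsLeafAt.isMaximumIndepSet_singleton (hl : IsLeafAt T l p) :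
    (T.induce {l, p}).IsMaximumIndepSet {⟨l, Set.mem_insert l {p}⟩} :=
  isMaximumIndepSet_singleton_of_isClique (isClique_pair.2 fun _ => hl.adj) _

theorem IsLeafAt.indepNum_eq (hl : IsLeafAt T l p) :
    T.indepNum = (T.induce {l, p}ᶜ).indepNum + 1 := by
  rw [indepNum_eq_add_indepNum_induce_compl hl.isMaximumIndepSet_singleton,
    ← maximumIndepSet_card_eq_indepNum _ hl.isMaximumIndepSet_singleton, Finset.card_singleton,
    add_comm]
  simpa using fun _ => hl.not_adj_of_mem_compl

theorem two_mul_indepNum_eq_of_isAcyclic (hT : T.IsAcyclic) :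
    2 * T.indepNum = 2 * (supp T).ncard + (nForest T).verts.ncard := by
  refine forest_leaf_induction
    (P := fun {W} _ T => 2 * T.indepNum = 2 * (supp T).ncard + (nForest T).verts.ncard)
    ?_ ?_ hT
  · intro W _
    have := Fintype.ofFinite W
    have huniv : (⊥ : SimpleGraph W).IsMaximumIndepSet Finset.univ :=
      ⟨by simp [Set.Pairwise], fun t _ => t.card_le_univ⟩
    rw [supp_bot, nForest_bot_verts, Set.ncard_univ, Set.ncard_empty, add_zero,
      ← maximumIndepSet_card_eq_indepNum _ huniv, Finset.card_univ, Nat.card_eq_fintype_card]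
  · intro W _ T hT hne ih
    obtain ⟨a, -, -⟩ := ne_bot_iff_exists_adj.1 hne
    obtain ⟨l, p, -, hl⟩ := exists_isLeafAt_ne hT hne a
    rw [hl.two_mul_ncard_supp_add_ncard_nForest hT, hl.indepNum_eq, mul_add_one, ih l p hl]

theorem exists_isMaximumIndepSet_notMem_of_notMem_supp (hT : T.IsAcyclic) {v : W}
    (hv : v ∉ supp T) : ∃ I : Finset W, T.IsMaximumIndepSet I ∧ v ∉ I := by
  classical
  refine forest_leaf_induction
    (P := fun {W} _ T => ∀ v ∉ supp T, ∃ I : Finset W, T.IsMaximumIndepSet I ∧ v ∉ I)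
    ?_ ?_ hT v hv
  · intro W _ v hv
    exact absurd (supp_bot (W := W) ▸ Set.mem_univ v) hv
  · intro W _ T hT hne ih v hv
    obtain ⟨l, p, hlv, hl⟩ := exists_isLeafAt_ne hT hne v
    obtain ⟨J, hJ, hvJ⟩ : ∃ J : Finset ({l, p}ᶜ : Set W),
        (T.induce {l, p}ᶜ).IsMaximumIndepSet J ∧ v ∉ J.map (.subtype (· ∈ ({l, p}ᶜ : Set W))) := by
      by_cases hvp : v = p
      · obtain ⟨J, hJ⟩ := maximumIndepSet_exists (G := T.induce {l, p}ᶜ)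
        exact ⟨J, hJ, by simp [hvp]⟩
      · have hvm : v ∈ ({l, p}ᶜ : Set W) := by simp [hlv.symm, hvp]
        obtain ⟨J, hJ, hvJ⟩ := ih l p hl ⟨v, hvm⟩ (hl.supp_induce_eq ▸ hv)
        exact ⟨J, hJ, by simpa using fun _ _ => hvJ⟩
    refine ⟨_, isMaximumIndepSet_map_val_union_map_val hl.isMaximumIndepSet_singleton hJ
      (by simpa using fun _ => hl.not_adj_of_mem_compl), ?_⟩
    rw [Finset.mem_union, not_or]
    exact ⟨by simpa using hlv.symm, hvJ⟩

end ForestIndependence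

section Pendant

variable {V : Type*} {G : SimpleGraph V} {C : G.Subgraph} {a b v : V}

theorem isAcyclic_induce_of_forall_not_subset {S : Set V}
    (hS : ∀ D : G.Subgraph, IsCycleSubgraph D → ¬ D.verts ⊆ S) : (G.induce S).IsAcyclic := by
  intro a q hq
  refine hS _ ⟨_, _, hq.map (f := (Embedding.induce S).toHom) Subtype.val_injective, rfl⟩ ?_
  intro c hc
  exact mem_of_mem_support_map_induce ((Walk.mem_verts_toSubgraph _).1 hc)

theorem IsCycleSubgraph.exists_mem_verts_ne (hC : IsCycleSubgraph C) (v : V) :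
    ∃ u ∈ C.verts, u ≠ v := by
  obtain ⟨a, q, hq, rfl⟩ := hC
  by_cases hav : a = v
  · exact ⟨q.snd, by simp, hav ▸ (q.adj_snd hq.not_nil).ne'⟩
  · exact ⟨a, by simp, hav⟩

theorem IsCycleSubgraph.connected (hC : IsCycleSubgraph C) : C.Connected := by
  obtain ⟨_, q, -, rfl⟩ := hC
  exact q.toSubgraph_connected

theorem isAcyclic_pendantTree (hG : ∀ D : G.Subgraph, IsCycleSubgraph D → D = C) (v : V) :
    (pendantTree G C v).IsAcyclic := by
  refine isAcyclic_induce_of_forall_not_subset fun D hD hsub => ?_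
  obtain ⟨u, huD, huv⟩ := hD.exists_mem_verts_ne v
  exact huv ((isGreatest_pendantVerts G C v).1.2.1 u (hsub huD) (hG D hD ▸ huD))

theorem isAcyclic_pendantCompl (hG : ∀ D : G.Subgraph, IsCycleSubgraph D → v ∈ D.verts) :
    (pendantCompl G C v).IsAcyclic :=
  isAcyclic_induce_of_forall_not_subset fun D hD hsub =>
    hsub (hG D hD) (mem_pendantVerts_self G C v)

theorem isBridge_of_forall_notMem_verts (hab : G.Adj a b)
    (ha : ∀ D : G.Subgraph, IsCycleSubgraph D → a ∉ D.verts) : G.IsBridge s(a, b) := by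
  rw [isBridge_iff_forall_cycle_notMem hab]
  intro u q hq hmem
  exact ha q.toSubgraph ⟨u, q, hq, rfl⟩
    ((Walk.mem_verts_toSubgraph q).2 (Walk.fst_mem_support_of_mem_edges q hmem))

theorem mem_pendantVerts_of_adj (ha : a ∈ pendantVerts G C v) (hab : G.Adj a b)
    (hb : b ∉ C.verts) : b ∈ pendantVerts G C v := by
  obtain ⟨hvP, hP, hconn⟩ := (isGreatest_pendantVerts G C v).1
  have hmem : pendantVerts G C v ∪ {a, b} ∈ pendantFamily G C v := by
    refine ⟨.inl hvP, ?_, ?_⟩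
    · rintro w (hw | rfl | rfl) hwC
      · exact hP w hw hwC
      · exact hP w ha hwC
      · exact absurd hwC hb
    · exact induce_union_connected hconn.preconnected
        (induce_pair_connected_of_adj hab).preconnected ⟨a, ha, .inl rfl⟩
  exact (isGreatest_pendantVerts G C v).2 hmem (.inr (.inr rfl))

theorem eq_of_adj_of_notMem_pendantVerts (hG : ∀ D : G.Subgraph, IsCycleSubgraph D → D = C)
    (hC : IsCycleSubgraph C) (hvC : v ∈ C.verts) (ha : a ∈ pendantVerts G C v)
    (hb : b ∉ pendantVerts G C v) (hab : G.Adj a b) : a = v := by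
  obtain ⟨hvP, hP, hPconn⟩ := (isGreatest_pendantVerts G C v).1
  by_contra hav
  have haC : a ∉ C.verts := fun h => hav (hP a ha h)
  have hbC : b ∈ C.verts := not_imp_comm.1 (mem_pendantVerts_of_adj ha hab) hb
  -- Walk from `a` to `v` in the pendant tree and on to `b` along `C`: the bridge `ab` is avoided.
  obtain ⟨q⟩ := hPconn.preconnected ⟨a, ha⟩ ⟨v, hvP⟩
  obtain ⟨r⟩ := hC.connected.induce_verts.preconnected ⟨v, hvC⟩ ⟨b, hbC⟩
  let q' : G.Walk a v := q.map (Embedding.induce _).toHom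
  let r' : G.Walk v b := r.map (Embedding.induce _).toHom
  have hmem : s(a, b) ∈ (q'.append r').edges := isBridge_iff_forall_walk_mem_edges.1
    (isBridge_of_forall_notMem_verts hab fun D hD => hG D hD ▸ haC) _
  rw [Walk.edges_append, List.mem_append] at hmem
  rcases hmem with h | h
  · exact hb (mem_of_mem_support_map_induce (Walk.snd_mem_support_of_mem_edges _ h))
  · exact haC (mem_of_mem_support_map_induce (Walk.fst_mem_support_of_mem_edges _ h))

end Pendant

end NullDecomp

open NullDecomp in
theorem mainTheorem2_general {V : Type*} [Finite V] {G : SimpleGraph V} {S : Set V} {v : S}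
    (hS : (G.induce S).IsAcyclic) (hSc : (G.induce Sᶜ).IsAcyclic)
    (hcut : ∀ a ∈ S, ∀ b ∉ S, G.Adj a b → a = v) (hv : v ∉ supp (G.induce S)) :
    (G.indepNum : ℚ) = (supp (G.induce S)).ncard + (supp (G.induce Sᶜ)).ncard
      + (((nForest (G.induce S)).verts.ncard : ℚ) + (nForest (G.induce Sᶜ)).verts.ncard) / 2 := by
  obtain ⟨I, hI, hvI⟩ := exists_isMaximumIndepSet_notMem_of_notMem_supp hS hv
  have hadj : ∀ a ∈ I, ∀ b ∉ S, ¬ G.Adj a b := fun a ha b hb hab =>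
    hvI (Subtype.ext (hcut a a.2 b hb hab) ▸ ha)
  have hsum := indepNum_eq_add_indepNum_induce_compl hI hadj
  have h₁ := two_mul_indepNum_eq_of_isAcyclic hS
  have h₂ := two_mul_indepNum_eq_of_isAcyclic hSc
  qify at hsum h₁ h₂
  linarith

theorem mainTheorem2 {V : Type*} [Finite V] (G : SimpleGraph V)
    (hG : NullDecomp.IsTypeI G)
    (C : G.Subgraph) (hC : NullDecomp.IsCycleSubgraph C)
    (v : V) (hvC : v ∈ C.verts)
    (hv : NullDecomp.pendantRoot G C v ∉ NullDecomp.supp (NullDecomp.pendantTree G C v)) :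
    (G.indepNum : ℚ) =
      (NullDecomp.supp (NullDecomp.pendantTree G C v)).ncard
        + (NullDecomp.supp (NullDecomp.pendantCompl G C v)).ncard
        + (((NullDecomp.nForest (NullDecomp.pendantTree G C v)).verts.ncard : ℚ)
          + (NullDecomp.nForest (NullDecomp.pendantCompl G C v)).verts.ncard) / 2 := by
  have hunique : ∀ D : G.Subgraph, NullDecomp.IsCycleSubgraph D → D = C :=
    fun _ hD => hG.1.2.unique hD hC
  exact mainTheorem2_general (NullDecomp.isAcyclic_pendantTree hunique v)
    (NullDecomp.isAcyclic_pendantCompl fun D hD => hunique D hD ▸ hvC)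
    (fun _ ha _ hb hab => NullDecomp.eq_of_adj_of_notMem_pendantVerts hunique hC hvC ha hb hab) hv
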